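/- Let $\mathbf N=\{1,2,3,\dots\}$. Let $t_1,t_2$ be bounded operators on a complex Hilbert space $\mathcal H$ with $t_i^*t_j=\delta_{ij}I$ and $t_1t_1^*+t_2t_2^*=I$ (that is, a unital $*$-representation of the Cuntz algebra $\mathcal O_2$), and let $\Omega\in\mathcal H$ be a unit vector, cyclic for this representation, with $t_1\Omega=\Omega$ (the representation $P_2(1)$). Let $\mathcal D$ be the linear span of the vectors $t_{i_1}\cdots t_{i_m}\Omega$, $m\ge 1$, $i_1,\dots,i_m\in\{1,2\}$. Put $s_m=t_2^{m-1}t_1$ for $m\ge1$. The recursive boson system consists of the operators on $\mathcal D$ (all sums are finite on each vector of $\mathcal D$) $$b_1=\sum_{m\ge1}\sqrt m\,s_ms_{m+1}^*,\qquad b_n=\rho(b_{n-1})\ (n\ge2),\qquad \rho(x)=\sum_{m\ge1}s_mxs_m^*,$$ together with their adjoints $b_1^*=\sum_{m\ge1}\sqrt m\,s_{m+1}s_m^*$, $b_n^*=\rho(b_{n-1}^*)$ on $\mathcal D$. The recursive fermion system consists of the bounded operators on $\mathcal H$ $$a_1=t_1t_2^*,\qquad a_n=\zeta(a_{n-1})\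 (n\ge2),\qquad \zeta(y)=t_1yt_1^*-t_2yt_2^*.$$ Denote by $\pi_{RBS}$ and $\pi_{RFS}$ the representations of the $*$-algebra $\mathcal B$ of bosons $\{b_n\}_{n\in\mathbf N}$ (canonical commutation relations) on $\mathcal D$ and of the $*$-algebra $\mathcal A$ of fermions $\{a_n\}_{n\in\mathbf N}$ (canonical anticommutation relations) on $\mathcal H$ given by these operators. Let $(\mathcal H_B,\pi_B)$ be the Fock representation of $\mathcal B$: $\pi_B$ acts by operators on a dense subspace $\mathcal D_B\subset\mathcal H_B$ (with $\pi_B(b_n)$ and $\pi_B(b_n^*)$ adjoint to each other on $\mathcal D_B$), and there is a unit vector $\Omega_B\in\mathcal D_B$ with $\pi_B(\mathcal B)\Omega_B=\mathcal D_B$ and $\pi_B(b_n)\Omega_B=0$ for all $n$. Let $(\mathcal H_F,\pi_F)$ be the Fock representation of $\mathcal A$: a $*$-representation by bounded operators on $\mathcal H_F$ with a unit vector $\Omega_F$ such that $\pi_F(\mathcal A)\Omega_F$ is dense in $\mathcal H_F$ and $\pi_F(a_n)\Omega_F=0$ for all $n$. Write $b_n,a_n$ also for $\pi_B(b_n),\pi_F(a_n)$.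 **Theorem 1.1.** There are a unique unitary $V_B:\mathcal H\to\mathcal H_B$ with $V_B\Omega=\Omega_B$, $V_B\mathcal D=\mathcal D_B$ and $V_B\pi_{RBS}(\cdot)V_B^*=\pi_B$ on $\mathcal D_B$, and a unique unitary $V_F:\mathcal H\to\mathcal H_F$ with $V_F\Omega=\Omega_F$ and $V_F\pi_{RFS}(\cdot)V_F^*=\pi_F$. The unitary $U=V_FV_B^*:\mathcal H_B\to\mathcal H_F$ has the following properties. (i) $U\Omega_B=\Omega_F$, and for all $1\le n_1<\cdots<n_m$ and $k_1,\dots,k_m\ge1$, $$U\,(b_{n_1}^*)^{k_1}\cdots(b_{n_m}^*)^{k_m}\Omega_B=\sqrt{k_1!\cdots k_m!}\;A_{n_1-1,k_1}A_{n_2+k_1-1,k_2}\cdots A_{n_m+k_1+\cdots+k_{m-1}-1,k_m}\Omega_F,$$ where $A_{n,k}=a_{n+1}^*a_{n+2}^*\cdots a_{n+k}^*$ for $n\ge0$, $k\ge1$. (ii) For $n\ge0$ let $\mathcal H_{B,n}$ and $\mathcal H_{F,n}$ be the $n$-particle subspaces, i.e. the closed linear spans of the vectors $b_{j_1}^*\cdots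 b_{j_n}^*\Omega_B$ and of the vectors $a_{j_1}^*\cdots a_{j_n}^*\Omega_F$, respectively, with $j_1,\dots,j_n\in\mathbf N$. Then $U\mathcal H_{B,n}=\mathcal H_{F,n}$ for every $n\ge0$. -/

import Mathlib

noncomputable section

/-- A representation of the Cuntz algebra `O₂` on `H` in the class `P₂(1)`: operators `t 0`, `t 1`
(the images of the canonical generators `t₁`, `t₂`) with `tᵢ* tⱼ = δᵢⱼ I` and
`t₁ t₁* + t₂ t₂* = I`, and a cyclic unit vector `Ω` with `t₁ Ω = Ω`. By the universal property of
`O₂`, such a pair of operators is the same thing as a unital `*`-representation of `O₂`. -/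
structure CuntzP21 (H : Type*) [NormedAddCommGroup H] [InnerProductSpace ℂ H]
    [CompleteSpace H] where
  t : Fin 2 → H →L[ℂ] H
  star_mul : ∀ i j, star (t i) * t j = if i = j then 1 else 0
  sum_mul_star : t 0 * star (t 0) + t 1 * star (t 1) = 1
  Ω : H
  norm_Ω : ‖Ω‖ = 1
  fixed : t 0 Ω = Ω
  cyclic : Dense {v : H | ∃ x ∈ StarAlgebra.adjoin ℂ (Set.range t), v = x Ω}

namespace CuntzP21

variable {H : Type*} [NormedAddCommGroup H] [InnerProductSpace ℂ H] [CompleteSpace H]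
  (P : CuntzP21 H)

/-- The dense subspace `D`: the linear span of the vectors `t_{i₁} ⋯ t_{iₘ} Ω` with `m ≥ 1`. -/
def D : Submodule ℂ H :=
  Submodule.span ℂ {v : H | ∃ w : List (Fin 2), w ≠ [] ∧ v = (w.map P.t).prod P.Ω}

theorem star_apply (i j : Fin 2) (v : H) :
    (star (P.t i)) (P.t j v) = if i = j then v else 0 := by
  have h := congrArg (fun f : H →L[ℂ] H => f v) (P.star_mul i j)
  change (star (P.t i)) (P.t j v) = _ at h
  rw [h]; split_ifs <;> simp

theorem word_mem (w : List (Fin 2)) : (w.map P.t).prod P.Ω ∈ P.D := by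
  apply Submodule.subset_span
  rcases w with _ | ⟨i, w⟩
  · exact ⟨[0], by simp, by simp [P.fixed]⟩
  · exact ⟨i :: w, by simp, rfl⟩

theorem Ω_mem : P.Ω ∈ P.D := by simpa using P.word_mem []

theorem t_mem (i : Fin 2) : ∀ v ∈ P.D, P.t i v ∈ P.D := by
  intro v hv
  induction hv using Submodule.span_induction with
  | mem x h => obtain ⟨w, -, rfl⟩ := h; simpa using P.word_mem (i :: w)
  | zero => simp
  | add x y _ _ hx hy => rw [map_add]; exact add_mem hx hy
  | smul c x _ hx => rw [map_smul]; exact Submodule.smul_mem _ _ hx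

theorem tStar_mem (i : Fin 2) : ∀ v ∈ P.D, (star (P.t i)) v ∈ P.D := by
  intro v hv
  induction hv using Submodule.span_induction with
  | mem x h =>
    obtain ⟨w, hw, rfl⟩ := h
    rcases w with _ | ⟨j, w⟩
    · exact absurd rfl hw
    · have h : ((j :: w).map P.t).prod P.Ω = P.t j ((w.map P.t).prod P.Ω) := by simp
      rw [h, star_apply]
      split_ifs
      · exact P.word_mem w
      · exact zero_mem _
  | zero => simp
  | add x y _ _ hx hy => rw [map_add]; exact add_mem hx hy
  | smul c x _ hx => rw [map_smul]; exact Submodule.smul_mem _ _ hx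

/-- The generators `t₁`, `t₂` (as `tD 0`, `tD 1`) acting on `D`. -/
def tD (i : Fin 2) : Module.End ℂ P.D := (P.t i : H →ₗ[ℂ] H).restrict (P.t_mem i)

/-- The adjoints `t₁*`, `t₂*` acting on `D`. -/
def tDStar (i : Fin 2) : Module.End ℂ P.D :=
  ((star (P.t i) : H →L[ℂ] H) : H →ₗ[ℂ] H).restrict (P.tStar_mem i)

/-- The generators of `O_∞` inside `O₂`, acting on `D`, counted from `0`:
`s m` is `s_{m+1} = t₂^m t₁`. -/
def s (m : ℕ) : Module.End ℂ P.D := P.tD 1 ^ m * P.tD 0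

/-- `sStar m` is `s_{m+1}* = t₁* (t₂*)^m`, acting on `D`. -/
def sStar (m : ℕ) : Module.End ℂ P.D := P.tDStar 0 * P.tDStar 1 ^ m

theorem tDStar_tD (i j : Fin 2) (v : P.D) :
    P.tDStar i (P.tD j v) = if i = j then v else 0 := by
  have h := P.star_apply i j v
  apply Subtype.ext
  change (star (P.t i)) (P.t j v) = _
  rw [h]; split_ifs <;> rfl

/-- On each vector of `D` only finitely many `sStar m` do not vanish, so that the series that
define the recursive boson system are finite sums on `D`. -/
theorem sStar_eventually (v : P.D) : ∃ M, ∀ m, M ≤ m → P.sStar m v = 0 := by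
  obtain ⟨v, hv⟩ := v
  induction hv using Submodule.span_induction with
  | mem x h =>
    obtain ⟨w, -, rfl⟩ := h
    suffices H : ∀ w : List (Fin 2), ∃ M, ∀ m, M ≤ m →
        (P.tDStar 1 ^ m) ⟨(w.map P.t).prod P.Ω, P.word_mem w⟩ = 0 by
      obtain ⟨M, hM⟩ := H w
      refine ⟨M, fun m hm => ?_⟩
      have := hM m hm
      simp only [sStar, Module.End.mul_apply]
      rw [this, map_zero]
    intro w
    induction w with
    | nil =>
      refine ⟨1, fun m hm => ?_⟩
      obtain ⟨m, rfl⟩ := Nat.exists_eq_add_of_le' hm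
      have e : (⟨(([] : List (Fin 2)).map P.t).prod P.Ω, P.word_mem []⟩ : P.D)
          = P.tD 0 ⟨P.Ω, P.Ω_mem⟩ := Subtype.ext (by
        change _ = P.t 0 P.Ω
        simp [P.fixed])
      rw [e, pow_succ, Module.End.mul_apply, tDStar_tD]
      simp
    | cons i w ih =>
      obtain ⟨M, hM⟩ := ih
      refine ⟨M + 1, fun m hm => ?_⟩
      obtain ⟨m, rfl⟩ := Nat.exists_eq_add_of_le' (Nat.le_trans (Nat.le_add_left 1 M) hm)
      have e : (⟨((i :: w).map P.t).prod P.Ω, P.word_mem (i :: w)⟩ : P.D)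
          = P.tD i ⟨(w.map P.t).prod P.Ω, P.word_mem w⟩ := Subtype.ext (by
        change _ = P.t i _
        simp)
      rw [e, pow_succ, Module.End.mul_apply, tDStar_tD]
      split_ifs
      · exact hM m (by omega)
      · simp
  | zero => exact ⟨0, fun m _ => (P.sStar m).map_zero⟩
  | add x y hx' hy' hx hy =>
    obtain ⟨M, hM⟩ := hx
    obtain ⟨N, hN⟩ := hy
    refine ⟨max M N, fun m hm => ?_⟩
    have h := (P.sStar m).map_add ⟨x, hx'⟩ ⟨y, hy'⟩
    rw [hM m (le_trans (le_max_left _ _) hm), hN m (le_trans (le_max_right _ _) hm),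
      add_zero] at h
    exact h
  | smul c x hx' hx =>
    obtain ⟨M, hM⟩ := hx
    refine ⟨M, fun m hm => ?_⟩
    have h := (P.sStar m).map_smul c ⟨x, hx'⟩
    rw [hM m hm, smul_zero] at h
    exact h

theorem finite_support (r : ℕ) (f : ℕ → Module.End ℂ P.D) (v : P.D) :
    (Function.support fun m => (f m * P.sStar (m + r)) v).Finite := by
  obtain ⟨M, hM⟩ := P.sStar_eventually v
  refine (Set.finite_lt_nat M).subset fun m hm => ?_
  by_contra h
  apply hm
  have h' : M ≤ m + r := by
    have : ¬ m < M := h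
    omega
  simp only [Module.End.mul_apply]
  rw [hM _ h', map_zero]

/-- The operator `∑_{m ≥ 0} f m * sStar (m + r)` on `D`; the sum is finite on each vector. -/
def series (r : ℕ) (f : ℕ → Module.End ℂ P.D) : Module.End ℂ P.D where
  toFun v := ∑ᶠ m, (f m * P.sStar (m + r)) v
  map_add' v w := by
    simp only [map_add]
    exact finsum_add_distrib (P.finite_support r f v) (P.finite_support r f w)
  map_smul' c v := by
    simp only [map_smul, RingHom.id_apply]
    exact (smul_finsum' c (P.finite_support r f v)).symm

/-- `ρ(x) = ∑_{m ≥ 1} s_m x s_m*` on `D`. -/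
def rho (x : Module.End ℂ P.D) : Module.End ℂ P.D := P.series 0 fun m => P.s m * x

/-- The recursive boson system on `D`, counted from `0` (`rbs n` is `b_{n+1}`):
`b₁ = ∑_{m ≥ 1} √m s_m s_{m+1}*` and `b_{n+1} = ρ(b_n)`. -/
def rbs : ℕ → Module.End ℂ P.D
  | 0 => P.series 1 fun m => ((Real.sqrt (m + 1) : ℝ) : ℂ) • P.s m
  | n + 1 => P.rho (rbs n)

/-- The adjoints on `D` of the recursive boson system: `b₁* = ∑_{m ≥ 1} √m s_{m+1} s_m*` and
`b_{n+1}* = ρ(b_n*)`. -/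
def rbsStar : ℕ → Module.End ℂ P.D
  | 0 => P.series 0 fun m => ((Real.sqrt (m + 1) : ℝ) : ℂ) • P.s (m + 1)
  | n + 1 => P.rho (rbsStar n)

/-- `ζ(y) = t₁ y t₁* - t₂ y t₂*`. -/
def zeta (y : H →L[ℂ] H) : H →L[ℂ] H :=
  P.t 0 * y * star (P.t 0) - P.t 1 * y * star (P.t 1)

/-- The recursive fermion system, counted from `0` (`rfs n` is `a_{n+1}`):
`a₁ = t₁ t₂*` and `a_{n+1} = ζ(a_n)`. -/
def rfs : ℕ → H →L[ℂ] H
  | 0 => P.t 0 * star (P.t 1)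
  | n + 1 => P.zeta (rfs n)

end CuntzP21

/-- A Fock representation of bosons on the Hilbert space `HB`: operators `b n` and `bStar n`
(counted from `0`, so that `b n` is `b_{n+1}`) on a dense subspace, adjoint to each other there,
with the canonical commutation relations, and a unit vector (the vacuum) which is annihilated by
all `b n` and is cyclic: the `*`-algebra generated by the bosons maps it onto the whole dense
subspace. -/
structure BoseFock (HB : Type*) [NormedAddCommGroup HB] [InnerProductSpace ℂ HB]
    [CompleteSpace HB] where
  dom : Submodule ℂ HB
  dense_dom : Dense (dom : Set HB)
  b : ℕ → Module.End ℂ dom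
  bStar : ℕ → Module.End ℂ dom
  adjoint_b : ∀ n (x y : dom), inner ℂ (bStar n x : HB) (y : HB) = inner ℂ (x : HB) (b n y : HB)
  ccr : ∀ n m, b n * bStar m - bStar m * b n = if n = m then 1 else 0
  b_comm : ∀ n m, b n * b m - b m * b n = 0
  bStar_comm : ∀ n m, bStar n * bStar m - bStar m * bStar n = 0
  vac : dom
  norm_vac : ‖(vac : HB)‖ = 1
  b_vac : ∀ n, b n vac = 0
  cyclic : ∀ x : dom, ∃ y ∈ Algebra.adjoin ℂ (Set.range b ∪ Set.range bStar), y vac = x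

/-- A Fock representation of fermions on the Hilbert space `HF`: bounded operators `a n`
(counted from `0`, so that `a n` is `a_{n+1}`) with the canonical anticommutation relations, and a
cyclic unit vector (the vacuum) which is annihilated by all `a n`. -/
structure FermiFock (HF : Type*) [NormedAddCommGroup HF] [InnerProductSpace ℂ HF]
    [CompleteSpace HF] where
  a : ℕ → HF →L[ℂ] HF
  car : ∀ n m, a n * star (a m) + star (a m) * a n = if n = m then 1 else 0
  a_anticomm : ∀ n m, a n * a m + a m * a n = 0
  aStar_anticomm : ∀ n m, star (a n) * star (a m) + star (a m) * star (a n) = 0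
  vac : HF
  norm_vac : ‖vac‖ = 1
  a_vac : ∀ n, a n vac = 0
  cyclic : Dense {v : HF | ∃ x ∈ StarAlgebra.adjoin ℂ (Set.range a), v = x vac}

/-- The `N`-particle subspace of the Bose-Fock space: the closed linear span of the vectors
`b_{j₁}* ⋯ b_{j_N}* Ω_B`. -/
def BoseFock.particle {HB : Type*} [NormedAddCommGroup HB] [InnerProductSpace ℂ HB]
    [CompleteSpace HB] (B : BoseFock HB) (N : ℕ) : Submodule ℂ HB :=
  (Submodule.span ℂ (Set.range fun j : Fin N → ℕ =>
    (((List.ofFn fun i => B.bStar (j i)).prod B.vac : B.dom) : HB))).topologicalClosure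

/-- The `N`-particle subspace of the Fermi-Fock space: the closed linear span of the vectors
`a_{j₁}* ⋯ a_{j_N}* Ω_F`. -/
def FermiFock.particle {HF : Type*} [NormedAddCommGroup HF] [InnerProductSpace ℂ HF]
    [CompleteSpace HF] (F : FermiFock HF) (N : ℕ) : Submodule ℂ HF :=
  (Submodule.span ℂ (Set.range fun j : Fin N → ℕ =>
    (List.ofFn fun i => star (F.a (j i))).prod F.vac)).topologicalClosure

/-- The block `A_{n,m} = a_{n+1}* ⋯ a_{n+m}*`; as `F.a` counts from `0`, these are the adjoints of
`F.a n, …, F.a (n + m - 1)`, in this order. -/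
def FermiFock.block {HF : Type*} [NormedAddCommGroup HF] [InnerProductSpace ℂ HF]
    [CompleteSpace HF] (F : FermiFock HF) (n m : ℕ) : HF →L[ℂ] HF :=
  (List.ofFn fun j : Fin m => star (F.a (n + j))).prod

/-- `V` is a unitary equivalence between the representation of bosons on `D` given by the
recursive boson system and a Fock representation of bosons, which maps `Ω` to the vacuum. -/
structure IsBoseEquiv {H HB : Type*} [NormedAddCommGroup H] [InnerProductSpace ℂ H]
    [CompleteSpace H] [NormedAddCommGroup HB] [InnerProductSpace ℂ HB] [CompleteSpace HB]
    (P : CuntzP21 H) (B : BoseFock HB) (V : H ≃ₗᵢ[ℂ] HB) : Prop where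
  map_Ω : V P.Ω = B.vac
  map_dom : ∀ v : H, v ∈ P.D ↔ V v ∈ B.dom
  map_b : ∀ (n : ℕ) (x : P.D) (y : B.dom), V x = y → V (P.rbs n x) = B.b n y
  map_bStar : ∀ (n : ℕ) (x : P.D) (y : B.dom), V x = y → V (P.rbsStar n x) = B.bStar n y

/-- `V` is a unitary equivalence between the representation of fermions on `H` given by the
recursive fermion system and a Fock representation of fermions, which maps `Ω` to the vacuum. -/
structure IsFermiEquiv {H HF : Type*} [NormedAddCommGroup H] [InnerProductSpace ℂ H]
    [CompleteSpace H] [NormedAddCommGroup HF] [InnerProductSpace ℂ HF] [CompleteSpace HF]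
    (P : CuntzP21 H) (F : FermiFock HF) (V : H ≃ₗᵢ[ℂ] HF) : Prop where
  map_Ω : V P.Ω = F.vac
  map_a : ∀ (n : ℕ) (x : H), V (P.rfs n x) = F.a n (V x)
  map_aStar : ∀ (n : ℕ) (x : H), V (star (P.rfs n) x) = star (F.a n) (V x)

end

noncomputable section

/-! ### Unitaries from equal Gram matrices -/

section GramEquivalence

variable {ι H K : Type*} [NormedAddCommGroup H] [InnerProductSpace ℂ H]
  [NormedAddCommGroup K] [InnerProductSpace ℂ K]

/-! A Fock representation is rigid. If annihilators `c n` and creators `d n` are adjoint to each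
other, satisfy `c n * d m = δ + ε d m * c n` and have a vacuum, then moving annihilators to the
right computes every inner product of two creation vectors, and the result depends only on `ε` and
the mode lists (`FockSystem.inner_vec_eq`). Families with equal Gram matrices and dense spans are
related by a unitary, which then intertwines the operators. So both equivalences exist once Ω is a
vacuum for each recursive system on `H` and its creation vectors are total.

Everything on `H` is computed by peeling letters off words in `t 0`, `t 1` applied to Ω. For
fermions, `t 0` raises every mode by one and `t 1 = a₁* t 0`. For bosons, `s 0 = t 0` raises every
mode by one and `(b₁*)^k s 0 = √k! s k`, where `s k = (t 1)^k (t 0)`. Since `t 0` fixes Ω, every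
word vector is a product of operators `s k` applied to Ω, hence lies in both creation spans.

On fermion vectors `(t 1)^k` puts `a₁* ⋯ aₖ*` in front and raises the other modes by `k`. A boson
mode occupied `k` times thus becomes a block of `k` consecutive fermion modes that pushes the later
ones up by `k`; induction on the number of distinct modes gives (i)
(`CuntzP21.coe_bose_vec_boseModes`). Both particle numbers count the letters `t 1`, so both
`N`-particle spans equal `wordSector N`, which gives (ii). -/

theorem inner_linearCombination_linearCombination (u : ι → H) (x y : ι →₀ ℂ) :
    inner ℂ (Finsupp.linearCombination ℂ u x) (Finsupp.linearCombination ℂ u y) =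
      x.sum fun i a => y.sum fun j b => starRingEnd ℂ a * (b * inner ℂ (u i) (u j)) := by
  simp only [Finsupp.linearCombination_apply, Finsupp.sum, sum_inner, inner_sum, inner_smul_left,
    inner_smul_right, Finset.mul_sum]
  rw [Finset.sum_comm]
  exact Finset.sum_congr rfl fun i _ => Finset.sum_congr rfl fun j _ => by ring

/-- Two total families of vectors with the same Gram matrix are related by a unitary. -/
theorem exists_linearIsometryEquiv_of_inner_eq [CompleteSpace H] [CompleteSpace K]
    {u : ι → H} {v : ι → K} (h : ∀ i j, (inner ℂ (u i) (u j) : ℂ) = inner ℂ (v i) (v j))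
    (hu : Dense (Submodule.span ℂ (Set.range u) : Set H))
    (hv : Dense (Submodule.span ℂ (Set.range v) : Set K)) :
    ∃ V : H ≃ₗᵢ[ℂ] K, ∀ i, V (u i) = v i := by
  have hu' : DenseRange (Finsupp.linearCombination ℂ u) := by
    rwa [← Finsupp.range_linearCombination, LinearMap.coe_range] at hu
  have hv' : DenseRange (Finsupp.linearCombination ℂ v) := by
    rwa [← Finsupp.range_linearCombination, LinearMap.coe_range] at hv
  -- The unitary is the extension of the identity on coefficient vectors, which is isometric because
  -- the Gram matrices agree.
  have hn (x : ι →₀ ℂ) : ‖Finsupp.linearCombination ℂ v (LinearEquiv.refl ℂ (ι →₀ ℂ) x)‖ =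
      ‖Finsupp.linearCombination ℂ u x‖ := by
    rw [LinearEquiv.refl_apply, @norm_eq_sqrt_re_inner ℂ, @norm_eq_sqrt_re_inner ℂ,
      inner_linearCombination_linearCombination, inner_linearCombination_linearCombination]
    simp only [h]
  refine ⟨(LinearEquiv.refl ℂ (ι →₀ ℂ)).extendOfIsometry _ _ hu' hv' hn, fun i => ?_⟩
  have := LinearEquiv.extendOfIsometry_eq (LinearEquiv.refl ℂ (ι →₀ ℂ)) _ _ hu' hv' hn
    (Finsupp.single i 1)
  simpa using this

end GramEquivalence

/-! ### Subspaces stable under generated algebras -/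

/-- A submodule which is stable under a set of operators is stable under the algebra that they
generate. -/
theorem Algebra.adjoin_apply_mem {R M : Type*} [CommRing R] [AddCommGroup M] [Module R M]
    {S : Set (Module.End R M)} {W : Submodule R M} (h : ∀ x ∈ S, ∀ v ∈ W, x v ∈ W)
    {x : Module.End R M} (hx : x ∈ Algebra.adjoin R S) : ∀ v ∈ W, x v ∈ W := by
  induction hx using Algebra.adjoin_induction with
  | mem x hx => exact h x hx
  | algebraMap r => exact fun v hv => by simpa [Module.algebraMap_end_apply] using W.smul_mem r hv
  | add x y _ _ hx hy => exact fun v hv => W.add_mem (hx v hv) (hy v hv)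
  | mul x y _ _ hx hy => exact fun v hv => hx _ (hy v hv)

/-- A submodule which is stable under a set of bounded operators and their adjoints is stable
under the `*`-algebra that they generate. -/
theorem StarAlgebra.adjoin_apply_mem {H : Type*} [NormedAddCommGroup H] [InnerProductSpace ℂ H]
    [CompleteSpace H] {S : Set (H →L[ℂ] H)} {W : Submodule ℂ H}
    (h : ∀ x ∈ S, ∀ v ∈ W, x v ∈ W) (h' : ∀ x ∈ S, ∀ v ∈ W, star x v ∈ W)
    {x : H →L[ℂ] H} (hx : x ∈ StarAlgebra.adjoin ℂ S) : ∀ v ∈ W, x v ∈ W := by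
  -- True by definition of the generated `*`-algebra; it leaves no closure under `star` to check.
  have hx' : x ∈ Algebra.adjoin ℂ (S ∪ star S) := hx
  clear hx
  induction hx' using Algebra.adjoin_induction with
  | mem x hx =>
    rcases hx with hx | hx
    · exact h x hx
    · simpa using h' (star x) hx
  | algebraMap r =>
    intro v hv
    simpa [Algebra.algebraMap_eq_smul_one] using W.smul_mem r hv
  | add x y _ _ hx hy => exact fun v hv => W.add_mem (hx v hv) (hy v hv)
  | mul x y _ _ hx hy => exact fun v hv => hx _ (hy v hv)

/-! ### Abstract Fock systems -/

/-- Annihilation operators `c n` and creation operators `d n` on an inner product space, formally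
adjoint to each other, with the relations `c n * d m = δ + ε d m * c n` and a vacuum vector. The
bosons are the case `ε = 1`, the fermions the case `ε = -1`. -/
structure FockSystem (ε : ℂ) (E : Type*) [NormedAddCommGroup E] [InnerProductSpace ℂ E] where
  c : ℕ → Module.End ℂ E
  d : ℕ → Module.End ℂ E
  adjoint : ∀ n x y, (inner ℂ (d n x) y : ℂ) = inner ℂ x (c n y)
  rel : ∀ n m x, c n (d m x) = (if n = m then x else 0) + ε • d m (c n x)
  vac : E
  norm_vac : ‖vac‖ = 1
  c_vac : ∀ n, c n vac = 0

namespace FockSystem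

variable {ε : ℂ} {E E' : Type*} [NormedAddCommGroup E] [InnerProductSpace ℂ E]
  [NormedAddCommGroup E'] [InnerProductSpace ℂ E'] (S : FockSystem ε E) (S' : FockSystem ε E')

/-- The vector obtained from the vacuum by a product of creation operators. -/
def vec (u : List ℕ) : E := (u.map S.d).prod S.vac

@[simp] theorem vec_nil : S.vec [] = S.vac := rfl

@[simp] theorem vec_cons (m : ℕ) (u : List ℕ) : S.vec (m :: u) = S.d m (S.vec u) := by
  simp [vec]

/-- The coefficients of `c n` applied to the vector of a list, as a combination of such
vectors. -/
def annih (ε : ℂ) (n : ℕ) : List ℕ → (List ℕ →₀ ℂ)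
  | [] => 0
  | m :: u => (if n = m then Finsupp.single u 1 else 0) + ε • (annih ε n u).mapDomain (m :: ·)

/-- The relation carries the annihilator to the right until it kills the vacuum. The point is that
the coefficients `annih ε n u` do not depend on the system. -/
theorem c_vec (n : ℕ) (u : List ℕ) :
    S.c n (S.vec u) = Finsupp.linearCombination ℂ S.vec (annih ε n u) := by
  induction u with
  | nil => simp [annih, S.c_vac]
  | cons m u ih =>
    have h : S.vec ∘ (m :: ·) = S.d m ∘ S.vec := by ext; simp
    rw [vec_cons, S.rel, ih, annih, map_add, map_smul, Finsupp.linearCombination_mapDomain, h,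
      LinearMap.map_finsupp_linearCombination]
    split_ifs <;> simp [Function.comp_def]

/-- Moving the first creator of `u` to the other side shortens `u` and turns `v` into a universal
combination of lists, hence the induction for all `v` at once. If `u` is empty, the first creator of
`v` moves over and kills the vacuum. -/
theorem inner_vec_eq (u v : List ℕ) :
    (inner ℂ (S.vec u) (S.vec v) : ℂ) = inner ℂ (S'.vec u) (S'.vec v) := by
  induction u generalizing v with
  | nil =>
    cases v with
    | nil => simp [S.norm_vac, S'.norm_vac, inner_self_eq_norm_sq_to_K]
    | cons m v =>
      rw [← inner_conj_symm, ← inner_conj_symm (S'.vec _)]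
      simp [adjoint, c_vac]
  | cons m u ih =>
    rw [vec_cons, vec_cons, adjoint, adjoint, c_vec, c_vec]
    simp [Finsupp.linearCombination_apply, Finsupp.inner_sum, inner_smul_right, ih]

theorem c_mem_span (n : ℕ) : ∀ x ∈ Submodule.span ℂ (Set.range S.vec),
    S.c n x ∈ Submodule.span ℂ (Set.range S.vec) := by
  change Submodule.span ℂ (Set.range S.vec) ≤
    (Submodule.span ℂ (Set.range S.vec)).comap (S.c n)
  rw [Submodule.span_le]
  rintro _ ⟨u, rfl⟩
  change S.c n (S.vec u) ∈ Submodule.span ℂ (Set.range S.vec)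
  rw [c_vec, ← Finsupp.range_linearCombination]
  exact LinearMap.mem_range_self _ _

theorem d_mem_span (n : ℕ) : ∀ x ∈ Submodule.span ℂ (Set.range S.vec),
    S.d n x ∈ Submodule.span ℂ (Set.range S.vec) := by
  change Submodule.span ℂ (Set.range S.vec) ≤
    (Submodule.span ℂ (Set.range S.vec)).comap (S.d n)
  rw [Submodule.span_le]
  rintro _ ⟨u, rfl⟩
  exact Submodule.subset_span ⟨n :: u, S.vec_cons n u⟩

variable {S S'}

/-- Both systems expand `c n` on creation vectors with the same coefficients, so matching these
vectors already intertwines the annihilators. -/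
theorem map_c_vec {T : E →ₗ[ℂ] E'} (hT : ∀ u, T (S.vec u) = S'.vec u) (n : ℕ) (u : List ℕ) :
    T (S.c n (S.vec u)) = S'.c n (T (S.vec u)) := by
  rw [hT, c_vec, c_vec, LinearMap.map_finsupp_linearCombination]
  congr 2
  ext u
  exact hT u

theorem map_d_vec {T : E →ₗ[ℂ] E'} (hT : ∀ u, T (S.vec u) = S'.vec u) (n : ℕ) (u : List ℕ) :
    T (S.d n (S.vec u)) = S'.d n (T (S.vec u)) := by
  rw [hT, ← vec_cons, ← vec_cons, hT]

end FockSystem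

/-! ### The given Fock representations as Fock systems -/

/-- The creation and annihilation operators of a Fock representation of bosons. -/
def BoseFock.system {HB : Type*} [NormedAddCommGroup HB] [InnerProductSpace ℂ HB]
    [CompleteSpace HB] (B : BoseFock HB) : FockSystem 1 B.dom where
  c := B.b
  d := B.bStar
  adjoint := B.adjoint_b
  rel n m x := by
    have h := congrArg (fun f : Module.End ℂ B.dom => f x) (B.ccr n m)
    simp only [LinearMap.sub_apply, Module.End.mul_apply] at h
    rw [one_smul, ← sub_eq_iff_eq_add, h]
    split_ifs <;> simp
  vac := B.vac
  norm_vac := B.norm_vac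
  c_vac := B.b_vac

theorem BoseFock.span_vec {HB : Type*} [NormedAddCommGroup HB] [InnerProductSpace ℂ HB]
    [CompleteSpace HB] (B : BoseFock HB) :
    Submodule.span ℂ (Set.range B.system.vec) = ⊤ := by
  refine eq_top_iff.2 fun x _ => ?_
  obtain ⟨y, hy, rfl⟩ := B.cyclic x
  refine Algebra.adjoin_apply_mem ?_ hy _ (Submodule.subset_span ⟨[], rfl⟩)
  rintro _ (⟨n, rfl⟩ | ⟨n, rfl⟩)
  · exact B.system.c_mem_span n
  · exact B.system.d_mem_span n

/-- The creation and annihilation operators of a Fock representation of fermions. -/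
def FermiFock.system {HF : Type*} [NormedAddCommGroup HF] [InnerProductSpace ℂ HF]
    [CompleteSpace HF] (F : FermiFock HF) : FockSystem (-1) HF where
  c n := (F.a n : HF →ₗ[ℂ] HF)
  d n := ((star (F.a n) : HF →L[ℂ] HF) : HF →ₗ[ℂ] HF)
  adjoint _ _ _ := ContinuousLinearMap.adjoint_inner_left _ _ _
  rel n m x := by
    have h := congrArg (fun f : HF →L[ℂ] HF => f x) (F.car n m)
    change F.a n (star (F.a m) x) + star (F.a m) (F.a n x) = _ at h
    change F.a n (star (F.a m) x) = _ + (-1 : ℂ) • star (F.a m) (F.a n x)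
    rw [neg_one_smul, ← sub_eq_add_neg, eq_sub_iff_add_eq, h]
    split_ifs <;> simp
  vac := F.vac
  norm_vac := F.norm_vac
  c_vac := F.a_vac

theorem FermiFock.dense_span_vec {HF : Type*} [NormedAddCommGroup HF] [InnerProductSpace ℂ HF]
    [CompleteSpace HF] (F : FermiFock HF) :
    Dense (Submodule.span ℂ (Set.range F.system.vec) : Set HF) := by
  refine F.cyclic.mono ?_
  rintro _ ⟨x, hx, rfl⟩
  refine StarAlgebra.adjoin_apply_mem ?_ ?_ hx _ (Submodule.subset_span ⟨[], rfl⟩)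
  · rintro _ ⟨n, rfl⟩
    exact F.system.c_mem_span n
  · rintro _ ⟨n, rfl⟩
    exact F.system.d_mem_span n

namespace CuntzP21

variable {H : Type*} [NormedAddCommGroup H] [InnerProductSpace ℂ H] [CompleteSpace H]
  (P : CuntzP21 H)

/-! ### The recursive fermion system -/

section Fermions

theorem eq_add (v : H) : v = P.t 0 (star (P.t 0) v) + P.t 1 (star (P.t 1) v) := by
  have h := congrArg (fun f : H →L[ℂ] H => f v) P.sum_mul_star
  exact h.symm

theorem inner_t_t (i j : Fin 2) (v w : H) :
    (inner ℂ (P.t i v) (P.t j w) : ℂ) = if i = j then inner ℂ v w else 0 := by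
  rw [← ContinuousLinearMap.adjoint_inner_right, ← ContinuousLinearMap.star_eq_adjoint,
    star_apply]
  split_ifs <;> simp

theorem star_rfs_succ (n : ℕ) : star (P.rfs (n + 1)) =
    P.t 0 * star (P.rfs n) * star (P.t 0) - P.t 1 * star (P.rfs n) * star (P.t 1) := by
  simp [rfs, zeta, mul_assoc]

theorem rfs_zero_t (i : Fin 2) (v : H) :
    P.rfs 0 (P.t i v) = if i = 1 then P.t 0 v else 0 := by
  change P.t 0 (star (P.t 1) (P.t i v)) = _
  rw [star_apply]
  fin_cases i <;> simp

theorem star_rfs_zero_t (i : Fin 2) (v : H) :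
    star (P.rfs 0) (P.t i v) = if i = 0 then P.t 1 v else 0 := by
  have h : star (P.rfs 0) = P.t 1 * star (P.t 0) := by simp [rfs]
  rw [h]
  change P.t 1 (star (P.t 0) (P.t i v)) = _
  rw [star_apply]
  fin_cases i <;> simp

theorem rfs_succ_t (n : ℕ) (i : Fin 2) (v : H) :
    P.rfs (n + 1) (P.t i v) = (if i = 0 then (1 : ℂ) else -1) • P.t i (P.rfs n v) := by
  change P.t 0 (P.rfs n (star (P.t 0) (P.t i v))) - P.t 1 (P.rfs n (star (P.t 1) (P.t i v))) = _
  rw [star_apply, star_apply]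
  fin_cases i <;> simp

theorem star_rfs_succ_t (n : ℕ) (i : Fin 2) (v : H) :
    star (P.rfs (n + 1)) (P.t i v) =
      (if i = 0 then (1 : ℂ) else -1) • P.t i (star (P.rfs n) v) := by
  rw [star_rfs_succ]
  change P.t 0 (star (P.rfs n) (star (P.t 0) (P.t i v))) -
    P.t 1 (star (P.rfs n) (star (P.t 1) (P.t i v))) = _
  rw [star_apply, star_apply]
  fin_cases i <;> simp

theorem rfs_Ω (n : ℕ) : P.rfs n P.Ω = 0 := by
  induction n with
  | zero => rw [← P.fixed, rfs_zero_t]; simp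
  | succ n ih => rw [← P.fixed, rfs_succ_t, ih]; simp

theorem eq_of_t {x y : H →L[ℂ] H} (h : ∀ i v, x (P.t i v) = y (P.t i v)) : x = y := by
  ext v
  rw [P.eq_add v, map_add, map_add, h, h]

/-- Checked on the ranges of `t 0` and `t 1`, which together span `H`. If both indices are positive,
the sign of `zeta` occurs twice and cancels, leaving the case of smaller indices. If exactly one is
zero, that operator changes the leading letter and the sign changes with it: this is the
anticommutation. -/
theorem rfs_mul_star_rfs (n m : ℕ) :
    P.rfs n * star (P.rfs m) = (if n = m then 1 else 0) - star (P.rfs m) * P.rfs n := by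
  induction n generalizing m with
  | zero =>
    refine P.eq_of_t fun i v => ?_
    cases m <;> fin_cases i <;>
      simp [rfs_zero_t, star_rfs_zero_t, star_rfs_succ_t]
  | succ n ih =>
    refine P.eq_of_t fun i v => ?_
    cases m with
    | zero => fin_cases i <;> simp [rfs_succ_t, star_rfs_zero_t]
    | succ m =>
      have h : P.rfs n (star (P.rfs m) v) = (if n = m then v else 0) -
          star (P.rfs m) (P.rfs n v) := by
        have h := congrArg (fun f : H →L[ℂ] H => f v) (ih m)
        simp only [sub_apply, mul_apply_eq_comp] at h
        rw [h]
        split_ifs <;> simp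
      obtain rfl | hnm := eq_or_ne n m
      · rw [if_pos rfl] at h
        fin_cases i <;> simp [rfs_succ_t, star_rfs_succ_t, h]
      · fin_cases i <;> simp [rfs_succ_t, star_rfs_succ_t, h, hnm]

/-- The recursive fermion system as a system of annihilation and creation operators on `H`. -/
def fermiSystem : FockSystem (-1) H where
  c n := (P.rfs n : H →ₗ[ℂ] H)
  d n := ((star (P.rfs n) : H →L[ℂ] H) : H →ₗ[ℂ] H)
  adjoint _ _ _ := ContinuousLinearMap.adjoint_inner_left _ _ _
  rel n m x := by
    have h := congrArg (fun f : H →L[ℂ] H => f x) (P.rfs_mul_star_rfs n m)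
    change P.rfs n (star (P.rfs m) x) = _ + (-1 : ℂ) • star (P.rfs m) (P.rfs n x)
    simp only [sub_apply, mul_apply_eq_comp] at h
    rw [h, neg_one_smul, sub_eq_add_neg]
    split_ifs <;> simp
  vac := P.Ω
  norm_vac := P.norm_Ω
  c_vac := P.rfs_Ω

theorem t_zero_fermi_vec (u : List ℕ) :
    P.t 0 (P.fermiSystem.vec u) = P.fermiSystem.vec (u.map (· + 1)) := by
  induction u with
  | nil => exact P.fixed
  | cons n u ih =>
    rw [List.map_cons, FockSystem.vec_cons, FockSystem.vec_cons, ← ih]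
    have h := P.star_rfs_succ_t n 0 (P.fermiSystem.vec u)
    rw [if_pos rfl, one_smul] at h
    exact h.symm

theorem t_one_fermi_vec (u : List ℕ) :
    P.t 1 (P.fermiSystem.vec u) = P.fermiSystem.vec (0 :: u.map (· + 1)) := by
  rw [FockSystem.vec_cons, ← t_zero_fermi_vec]
  have h := P.star_rfs_zero_t 0 (P.fermiSystem.vec u)
  rw [if_pos rfl] at h
  exact h.symm

end Fermions

/-! ### The recursive boson system -/

section Bosons

theorem sStar_s (m k : ℕ) (v : P.D) :
    P.sStar m (P.s k v) = if m = k then v else 0 := by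
  simp only [sStar, s, Module.End.mul_apply]
  induction m generalizing k with
  | zero =>
    cases k with
    | zero => simp [tDStar_tD]
    | succ k => simp [pow_succ', tDStar_tD]
  | succ m ih =>
    cases k with
    | zero => simp [pow_succ, tDStar_tD]
    | succ k => simp [pow_succ _ m, pow_succ' _ k, tDStar_tD, ih]

theorem series_s (r : ℕ) (f : ℕ → Module.End ℂ P.D) (k : ℕ) (v : P.D) :
    P.series r f (P.s k v) = if r ≤ k then f (k - r) v else 0 := by
  change ∑ᶠ m, f m (P.sStar (m + r) (P.s k v)) = _
  simp only [sStar_s]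
  split_ifs with h
  · rw [finsum_eq_single _ (k - r)]
    · simp [Nat.sub_add_cancel h]
    · intro m hm
      rw [if_neg (by omega), map_zero]
  · refine finsum_eq_zero_of_forall_eq_zero fun m => ?_
    rw [if_neg (by omega), map_zero]

theorem rho_s (x : Module.End ℂ P.D) (k : ℕ) (v : P.D) : P.rho x (P.s k v) = P.s k (x v) := by
  simp [rho, series_s]

theorem rbs_zero_s_zero (v : P.D) : P.rbs 0 (P.s 0 v) = 0 := by
  simp [rbs, series_s]

theorem rbs_zero_s_succ (k : ℕ) (v : P.D) :
    P.rbs 0 (P.s (k + 1) v) = ((Real.sqrt (k + 1) : ℝ) : ℂ) • P.s k v := by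
  simp [rbs, series_s]

theorem rbsStar_zero_s (k : ℕ) (v : P.D) :
    P.rbsStar 0 (P.s k v) = ((Real.sqrt (k + 1) : ℝ) : ℂ) • P.s (k + 1) v := by
  simp [rbsStar, series_s]

theorem rbs_succ_s (n k : ℕ) (v : P.D) : P.rbs (n + 1) (P.s k v) = P.s k (P.rbs n v) :=
  P.rho_s _ k v

theorem rbsStar_succ_s (n k : ℕ) (v : P.D) :
    P.rbsStar (n + 1) (P.s k v) = P.s k (P.rbsStar n v) :=
  P.rho_s _ k v

/-- The vacuum as a vector of `D`. -/
def ΩD : P.D := ⟨P.Ω, P.Ω_mem⟩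

theorem tD_zero_ΩD : P.tD 0 P.ΩD = P.ΩD := Subtype.ext P.fixed

theorem s_zero_ΩD : P.s 0 P.ΩD = P.ΩD := by simpa [s] using P.tD_zero_ΩD

/-- The vector `t_{i₁} ⋯ t_{iₘ} Ω`. -/
def word (w : List (Fin 2)) : P.D := (w.map P.tD).prod P.ΩD

@[simp] theorem word_nil : P.word [] = P.ΩD := rfl

@[simp] theorem word_cons (i : Fin 2) (w : List (Fin 2)) :
    P.word (i :: w) = P.tD i (P.word w) := by
  simp [word]

theorem coe_word (w : List (Fin 2)) : (P.word w : H) = (w.map P.t).prod P.Ω := by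
  induction w with
  | nil => rfl
  | cons i w ih =>
    rw [word_cons, List.map_cons, List.prod_cons, mul_apply_eq_comp, ← ih]
    rfl

theorem span_word : Submodule.span ℂ (Set.range P.word) = ⊤ := by
  refine eq_top_iff.2 ?_
  rintro ⟨v, hv⟩ -
  induction hv using Submodule.span_induction with
  | mem x h =>
    obtain ⟨w, -, rfl⟩ := h
    exact Submodule.subset_span ⟨w, Subtype.ext (P.coe_word w)⟩
  | zero => exact zero_mem _
  | add x y hx' hy' hx hy => exact add_mem hx hy
  | smul c x hx' hx => exact Submodule.smul_mem _ c hx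

/-- A word splits after its first `t 0` into some `s l` and a remainder; a word without `t 0`
borrows one from `t 0 Ω = Ω`. -/
theorem span_s : Submodule.span ℂ {x | ∃ k v, x = P.s k v} = ⊤ := by
  rw [eq_top_iff, ← span_word, Submodule.span_le]
  rintro _ ⟨w, rfl⟩
  -- The exponent `k` stores the letters `t 1` already read.
  suffices h : ∀ w k, ∃ l v, (P.tD 1 ^ k) (P.word w) = P.s l v from Submodule.subset_span (h w 0)
  intro w
  induction w with
  | nil => exact fun k => ⟨k, P.ΩD, by simp [s, tD_zero_ΩD]⟩
  | cons i w ih =>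
    intro k
    fin_cases i
    · exact ⟨k, P.word w, by simp [s]⟩
    · obtain ⟨l, v, h⟩ := ih (k + 1)
      exact ⟨l, v, by simpa [pow_succ] using h⟩

theorem end_ext {x y : Module.End ℂ P.D} (h : ∀ k v, x (P.s k v) = y (P.s k v)) : x = y :=
  LinearMap.ext_on P.span_s fun _ ⟨k, v, hv⟩ => hv ▸ h k v

theorem rbs_ΩD (n : ℕ) : P.rbs n P.ΩD = 0 := by
  induction n with
  | zero => rw [← P.s_zero_ΩD, rbs_zero_s_zero]
  | succ n ih => rw [← P.s_zero_ΩD, rbs_succ_s, ih, map_zero]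

theorem sqrt_smul_sqrt_smul (k : ℕ) (v : P.D) :
    ((Real.sqrt (k + 1) : ℝ) : ℂ) • ((Real.sqrt (k + 1) : ℝ) : ℂ) • v = ((k : ℂ) + 1) • v := by
  rw [smul_smul, ← Complex.ofReal_mul, Real.mul_self_sqrt (by positivity)]
  simp

/-- On `s k v` the first mode is a harmonic oscillator at level `k`, while the mode of index `n + 1`
passes `s k` and acts on `v` as the mode of index `n`. -/
theorem rbs_mul_rbsStar (n m : ℕ) :
    P.rbs n * P.rbsStar m = (if n = m then 1 else 0) + P.rbsStar m * P.rbs n := by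
  induction n generalizing m with
  | zero =>
    refine P.end_ext fun k v => ?_
    cases m with
    | zero =>
      cases k with
      | zero => simp [rbs_zero_s_zero, rbsStar_zero_s, rbs_zero_s_succ]
      | succ k =>
        simp only [Module.End.mul_apply, LinearMap.add_apply, rbsStar_zero_s, map_smul,
          rbs_zero_s_succ, sqrt_smul_sqrt_smul, if_true, Module.End.one_apply]
        push_cast
        module
    | succ m => cases k <;> simp [rbs_zero_s_zero, rbsStar_succ_s, rbs_zero_s_succ]
  | succ n ih =>
    refine P.end_ext fun k v => ?_
    cases m with
    | zero => simp [rbsStar_zero_s, rbs_succ_s]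
    | succ m =>
      have h := congrArg (fun f : Module.End ℂ P.D => f v) (ih m)
      simp only [Module.End.mul_apply, LinearMap.add_apply] at h
      simp only [Module.End.mul_apply, LinearMap.add_apply, rbsStar_succ_s, rbs_succ_s, h, map_add]
      split_ifs <;> simp_all

theorem inner_tD_tD (i j : Fin 2) (v w : P.D) :
    (inner ℂ (P.tD i v) (P.tD j w) : ℂ) = if i = j then inner ℂ v w else 0 :=
  P.inner_t_t i j v w

theorem inner_s_s (k l : ℕ) (v w : P.D) :
    (inner ℂ (P.s k v) (P.s l w) : ℂ) = if k = l then inner ℂ v w else 0 := by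
  simp only [s, Module.End.mul_apply]
  induction k generalizing l with
  | zero => cases l <;> simp [-Submodule.coe_inner, pow_succ', inner_tD_tD]
  | succ k ih => cases l <;> simp [-Submodule.coe_inner, pow_succ', inner_tD_tD, ih]

theorem inner_eq_of_s {x y : Module.End ℂ P.D}
    (h : ∀ k v l w, (inner ℂ (x (P.s k v)) (P.s l w) : ℂ) = inner ℂ (P.s k v) (y (P.s l w)))
    (v w : P.D) : (inner ℂ (x v) w : ℂ) = inner ℂ v (y w) := by
  have hv : v ∈ Submodule.span ℂ {x | ∃ k v, x = P.s k v} := P.span_s ▸ Submodule.mem_top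
  have hw : w ∈ Submodule.span ℂ {x | ∃ k v, x = P.s k v} := P.span_s ▸ Submodule.mem_top
  induction hv using Submodule.span_induction with
  | mem v hv =>
    obtain ⟨k, v, rfl⟩ := hv
    induction hw using Submodule.span_induction with
    | mem w hw =>
      obtain ⟨l, w, rfl⟩ := hw
      exact h k v l w
    | zero => simp
    | add w w' _ _ hw hw' => rw [inner_add_right, map_add, inner_add_right, hw, hw']
    | smul c w _ hw => rw [inner_smul_right, map_smul, inner_smul_right, hw]
  | zero => simp
  | add v v' _ _ hv hv' => rw [inner_add_left, map_add, inner_add_left, hv, hv']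
  | smul c v _ hv => rw [inner_smul_left, map_smul, inner_smul_left, hv]

theorem inner_rbsStar (n : ℕ) (v w : P.D) :
    (inner ℂ (P.rbsStar n v) w : ℂ) = inner ℂ v (P.rbs n w) := by
  induction n generalizing v w with
  | zero =>
    refine P.inner_eq_of_s (fun k v l w => ?_) v w
    rw [rbsStar_zero_s]
    cases l with
    | zero => simp [-Submodule.coe_inner, rbs_zero_s_zero, inner_s_s]
    | succ l =>
      rw [rbs_zero_s_succ, inner_smul_left, inner_smul_right, inner_s_s, inner_s_s]
      by_cases h : k = l <;> simp [h]
  | succ n ih =>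
    refine P.inner_eq_of_s (fun k v l w => ?_) v w
    rw [rbsStar_succ_s, rbs_succ_s, inner_s_s, inner_s_s, ih]

/-- The recursive boson system as a system of annihilation and creation operators on `D`. -/
def boseSystem : FockSystem 1 P.D where
  c := P.rbs
  d := P.rbsStar
  adjoint := P.inner_rbsStar
  rel n m x := by
    have h := congrArg (fun f : Module.End ℂ P.D => f x) (P.rbs_mul_rbsStar n m)
    simp only [Module.End.mul_apply, LinearMap.add_apply] at h
    rw [one_smul, h]
    split_ifs <;> simp
  vac := P.ΩD
  norm_vac := P.norm_Ω
  c_vac := P.rbs_ΩD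

end Bosons

end CuntzP21

/-! ### Particle sectors and words -/

theorem LinearMap.apply_mem_of_mem_span {R M N : Type*} [CommRing R] [AddCommGroup M] [Module R M]
    [AddCommGroup N] [Module R N] {f : M →ₗ[R] N} {s : Set M} {W : Submodule R N}
    (h : ∀ x ∈ s, f x ∈ W) : ∀ x ∈ Submodule.span R s, f x ∈ W :=
  fun _ hx => (Submodule.span_le (p := W.comap f)).2 h hx

/-- The span of the `N`-particle vectors. -/
def FockSystem.sector {ε : ℂ} {E : Type*} [NormedAddCommGroup E] [InnerProductSpace ℂ E]
    (S : FockSystem ε E) (N : ℕ) : Submodule ℂ E :=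
  Submodule.span ℂ (S.vec '' {u | u.length = N})

theorem FockSystem.vec_mem_sector {ε : ℂ} {E : Type*} [NormedAddCommGroup E]
    [InnerProductSpace ℂ E] (S : FockSystem ε E) (u : List ℕ) : S.vec u ∈ S.sector u.length :=
  Submodule.subset_span ⟨u, rfl, rfl⟩

theorem FockSystem.d_mem_sector {ε : ℂ} {E : Type*} [NormedAddCommGroup E]
    [InnerProductSpace ℂ E] (S : FockSystem ε E) (n N : ℕ) :
    ∀ x ∈ S.sector N, S.d n x ∈ S.sector (N + 1) := by
  refine LinearMap.apply_mem_of_mem_span ?_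
  rintro _ ⟨u, rfl, rfl⟩
  simpa using S.vec_mem_sector (n :: u)

namespace CuntzP21

variable {H : Type*} [NormedAddCommGroup H] [InnerProductSpace ℂ H] [CompleteSpace H]
  (P : CuntzP21 H)

section Sectors

theorem s_succ_apply (k : ℕ) (v : P.D) : P.s (k + 1) v = P.tD 1 (P.s k v) := by
  simp [s, pow_succ']

theorem s_succ_eq_smul (k : ℕ) (v : P.D) :
    P.s (k + 1) v = ((Real.sqrt (k + 1) : ℝ) : ℂ)⁻¹ • P.rbsStar 0 (P.s k v) := by
  have h : ((Real.sqrt (k + 1) : ℝ) : ℂ) ≠ 0 :=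
    Complex.ofReal_ne_zero.2 (Real.sqrt_pos.2 (by positivity)).ne'
  rw [rbsStar_zero_s, inv_smul_smul₀ h]

theorem s_zero_bose_vec (u : List ℕ) :
    P.s 0 (P.boseSystem.vec u) = P.boseSystem.vec (u.map (· + 1)) := by
  induction u with
  | nil => exact P.s_zero_ΩD
  | cons n u ih =>
    rw [List.map_cons, FockSystem.vec_cons, FockSystem.vec_cons, ← ih]
    exact (P.rbsStar_succ_s n 0 _).symm

/-- `s 0` only shifts modes, and each step from `s k` to `s (k + 1)` is a multiple of `b₁*`, so adds
one particle. -/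
theorem s_mem_bose_sector (k N : ℕ) :
    ∀ v ∈ P.boseSystem.sector N, P.s k v ∈ P.boseSystem.sector (k + N) := by
  induction k with
  | zero =>
    rw [zero_add]
    refine LinearMap.apply_mem_of_mem_span ?_
    rintro _ ⟨u, rfl, rfl⟩
    rw [s_zero_bose_vec]
    simpa using P.boseSystem.vec_mem_sector (u.map (· + 1))
  | succ k ih =>
    intro v hv
    rw [s_succ_eq_smul, Nat.add_right_comm]
    exact Submodule.smul_mem _ _ (P.boseSystem.d_mem_sector 0 _ _ (ih v hv))

/-- The span of the vectors `t_{i₁} ⋯ t_{iₘ} Ω` in which `t₂` occurs `N` times. -/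
def wordSector (N : ℕ) : Submodule ℂ P.D := Submodule.span ℂ (P.word '' {w | w.count 1 = N})

theorem word_mem_wordSector (w : List (Fin 2)) : P.word w ∈ P.wordSector (w.count 1) :=
  Submodule.subset_span ⟨w, rfl, rfl⟩

theorem tD_zero_mem_wordSector (N : ℕ) : ∀ v ∈ P.wordSector N, P.tD 0 v ∈ P.wordSector N := by
  refine LinearMap.apply_mem_of_mem_span ?_
  rintro _ ⟨w, rfl, rfl⟩
  simpa using P.word_mem_wordSector (0 :: w)

theorem tD_one_mem_wordSector (N : ℕ) :
    ∀ v ∈ P.wordSector N, P.tD 1 v ∈ P.wordSector (N + 1) := by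
  refine LinearMap.apply_mem_of_mem_span ?_
  rintro _ ⟨w, rfl, rfl⟩
  simpa using P.word_mem_wordSector (1 :: w)

theorem s_mem_wordSector (k N : ℕ) :
    ∀ v ∈ P.wordSector N, P.s k v ∈ P.wordSector (N + k) := by
  intro v hv
  induction k with
  | zero => simpa [s] using P.tD_zero_mem_wordSector N v hv
  | succ k ih => exact s_succ_apply P k v ▸ P.tD_one_mem_wordSector _ _ ih

theorem pow_word_mem_bose_sector (w : List (Fin 2)) (k : ℕ) :
    (P.tD 1 ^ k) (P.word w) ∈ P.boseSystem.sector (k + w.count 1) := by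
  induction w generalizing k with
  | nil =>
    rw [word_nil, ← tD_zero_ΩD]
    exact P.s_mem_bose_sector k 0 _ (P.boseSystem.vec_mem_sector [])
  | cons i w ih =>
    obtain rfl | rfl : i = 0 ∨ i = 1 := by fin_cases i <;> simp
    · simpa [s] using P.s_mem_bose_sector k _ _ (by simpa using ih 0)
    · have h := ih (k + 1)
      rw [pow_succ, Module.End.mul_apply] at h
      simpa [add_assoc, add_comm 1] using h

/-- Every boson creator adds one letter `t 1`: `b₁*` turns the leading `s k` into a multiple of `s
(k + 1)`, and the later ones pass `s k`. The inner inductions on `w` search for the `t 0` that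
completes `s k`. -/
theorem rbsStar_pow_word_mem (n : ℕ) (w : List (Fin 2)) (k : ℕ) :
    P.rbsStar n ((P.tD 1 ^ k) (P.word w)) ∈ P.wordSector (w.count 1 + k + 1) := by
  induction n generalizing w k with
  | zero =>
    induction w generalizing k with
    | nil =>
      have h : (P.tD 1 ^ k) (P.word []) = P.s k P.ΩD := by simp [s, tD_zero_ΩD]
      rw [h, rbsStar_zero_s]
      exact Submodule.smul_mem _ _ (P.s_mem_wordSector (k + 1) 0 _ (P.word_mem_wordSector []))
    | cons i w ih =>
      obtain rfl | rfl : i = 0 ∨ i = 1 := by fin_cases i <;> simp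
      · have h : (P.tD 1 ^ k) (P.word (0 :: w)) = P.s k (P.word w) := by simp [s]
        rw [h, rbsStar_zero_s]
        refine Submodule.smul_mem _ _ ?_
        simpa [add_assoc] using P.s_mem_wordSector (k + 1) _ _ (P.word_mem_wordSector w)
      · have h := ih (k + 1)
        rw [pow_succ, Module.End.mul_apply] at h
        simpa [add_assoc, add_comm, add_left_comm] using h
  | succ n ih =>
    induction w generalizing k with
    | nil =>
      have h : (P.tD 1 ^ k) (P.word []) = P.s k P.ΩD := by simp [s, tD_zero_ΩD]
      rw [h, rbsStar_succ_s]
      have h' := P.s_mem_wordSector k _ _ (ih [] 0)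
      simpa [add_comm] using h'
    | cons i w ihw =>
      obtain rfl | rfl : i = 0 ∨ i = 1 := by fin_cases i <;> simp
      · have h : (P.tD 1 ^ k) (P.word (0 :: w)) = P.s k (P.word w) := by simp [s]
        rw [h, rbsStar_succ_s]
        have h' := P.s_mem_wordSector k _ _ (ih w 0)
        simpa [add_assoc, add_comm 1] using h'
      · have h := ihw (k + 1)
        rw [pow_succ, Module.End.mul_apply] at h
        simpa [add_assoc, add_comm, add_left_comm] using h

theorem bose_vec_mem_wordSector (u : List ℕ) : P.boseSystem.vec u ∈ P.wordSector u.length := by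
  induction u with
  | nil => exact P.word_mem_wordSector []
  | cons n u ih =>
    rw [FockSystem.vec_cons]
    refine LinearMap.apply_mem_of_mem_span (f := P.boseSystem.d n) ?_ _ ih
    rintro _ ⟨w, hw, rfl⟩
    have hw : w.count 1 = u.length := hw
    rw [List.length_cons, ← hw]
    exact P.rbsStar_pow_word_mem n w 0

theorem bose_sector_eq (N : ℕ) : P.boseSystem.sector N = P.wordSector N := by
  apply le_antisymm
  · refine Submodule.span_le.2 ?_
    rintro _ ⟨u, rfl, rfl⟩
    exact P.bose_vec_mem_wordSector u
  · refine Submodule.span_le.2 ?_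
    rintro _ ⟨w, rfl, rfl⟩
    simpa using P.pow_word_mem_bose_sector w 0

theorem span_bose_vec : Submodule.span ℂ (Set.range P.boseSystem.vec) = ⊤ := by
  rw [eq_top_iff, ← span_word, Submodule.span_le]
  rintro _ ⟨w, rfl⟩
  have h := P.pow_word_mem_bose_sector w 0
  exact Submodule.span_mono (Set.image_subset_range _ _) h

theorem t_zero_mem_fermi_sector (N : ℕ) :
    ∀ v ∈ P.fermiSystem.sector N, P.t 0 v ∈ P.fermiSystem.sector N := by
  refine LinearMap.apply_mem_of_mem_span (f := (P.t 0 : H →ₗ[ℂ] H)) ?_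
  rintro _ ⟨u, rfl, rfl⟩
  simpa [t_zero_fermi_vec] using P.fermiSystem.vec_mem_sector (u.map (· + 1))

theorem t_one_mem_fermi_sector (N : ℕ) :
    ∀ v ∈ P.fermiSystem.sector N, P.t 1 v ∈ P.fermiSystem.sector (N + 1) := by
  refine LinearMap.apply_mem_of_mem_span (f := (P.t 1 : H →ₗ[ℂ] H)) ?_
  rintro _ ⟨u, rfl, rfl⟩
  have h := P.fermiSystem.vec_mem_sector (0 :: u.map (· + 1))
  rw [← t_one_fermi_vec] at h
  simpa using h

theorem coe_word_cons (i : Fin 2) (w : List (Fin 2)) :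
    (P.word (i :: w) : H) = P.t i (P.word w) := by
  rw [word_cons]; rfl

theorem coe_word_mem_fermi_sector (w : List (Fin 2)) :
    (P.word w : H) ∈ P.fermiSystem.sector (w.count 1) := by
  induction w with
  | nil => exact P.fermiSystem.vec_mem_sector []
  | cons i w ih =>
    rw [coe_word_cons]
    obtain rfl | rfl : i = 0 ∨ i = 1 := by fin_cases i <;> simp
    · simpa using P.t_zero_mem_fermi_sector _ _ ih
    · simpa using P.t_one_mem_fermi_sector _ _ ih

/-- `a₁*` turns a leading `t 0` into `t 1` and kills a leading `t 1`; the later creators pass the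
leading letter up to sign. So again one letter `t 1` is gained. -/
theorem star_rfs_word_mem (n : ℕ) (w : List (Fin 2)) :
    star (P.rfs n) (P.word w : H) ∈ (P.wordSector (w.count 1 + 1)).map P.D.subtype := by
  have key (i : Fin 2) (w : List (Fin 2)) (n : ℕ)
      (ih : ∀ w : List (Fin 2), star (P.rfs n) (P.word w : H) ∈
        (P.wordSector (w.count 1 + 1)).map P.D.subtype) :
      star (P.rfs (n + 1)) (P.word (i :: w) : H) ∈
        (P.wordSector ((i :: w).count 1 + 1)).map P.D.subtype := by
    obtain ⟨x, hx, hx'⟩ := ih w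
    rw [coe_word_cons, star_rfs_succ_t, ← hx']
    refine Submodule.smul_mem _ _ ⟨P.tD i x, ?_, rfl⟩
    obtain rfl | rfl : i = 0 ∨ i = 1 := by fin_cases i <;> simp
    · simpa using P.tD_zero_mem_wordSector _ _ hx
    · simpa using P.tD_one_mem_wordSector _ _ hx
  have key₀ (i : Fin 2) (w : List (Fin 2)) :
      star (P.rfs 0) (P.word (i :: w) : H) ∈
        (P.wordSector ((i :: w).count 1 + 1)).map P.D.subtype := by
    rw [coe_word_cons, star_rfs_zero_t]
    obtain rfl | rfl : i = 0 ∨ i = 1 := by fin_cases i <;> simp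
    · exact ⟨P.word (1 :: w), by simpa using P.word_mem_wordSector (1 :: w),
        by rw [if_pos rfl]; exact P.coe_word_cons 1 w⟩
    · simp
  -- The empty word has no leading letter to act on; `t 0 Ω = Ω` supplies one.
  have hΩ : P.word [] = P.word [0] := by simp [tD_zero_ΩD]
  induction n generalizing w with
  | zero =>
    cases w with
    | nil => rw [hΩ]; exact key₀ 0 []
    | cons i w => exact key₀ i w
  | succ n ih =>
    cases w with
    | nil => rw [hΩ]; exact key 0 [] n ih
    | cons i w => exact key i w n ih

theorem fermi_vec_mem (u : List ℕ) :
    P.fermiSystem.vec u ∈ (P.wordSector u.length).map P.D.subtype := by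
  induction u with
  | nil => exact ⟨P.word [], P.word_mem_wordSector [], rfl⟩
  | cons n u ih =>
    obtain ⟨x, hx, hx'⟩ := ih
    rw [FockSystem.vec_cons, ← hx']
    refine LinearMap.apply_mem_of_mem_span (f := P.fermiSystem.d n ∘ₗ P.D.subtype) ?_ _ hx
    rintro _ ⟨w, hw, rfl⟩
    have hw : w.count 1 = u.length := hw
    rw [List.length_cons, ← hw]
    exact P.star_rfs_word_mem n w

theorem fermi_sector_eq (N : ℕ) :
    P.fermiSystem.sector N = (P.wordSector N).map P.D.subtype := by
  apply le_antisymm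
  · refine Submodule.span_le.2 ?_
    rintro _ ⟨u, rfl, rfl⟩
    exact P.fermi_vec_mem u
  · refine Submodule.map_le_iff_le_comap.2 (Submodule.span_le.2 ?_)
    rintro _ ⟨w, rfl, rfl⟩
    exact P.coe_word_mem_fermi_sector w

theorem dense_D : Dense (P.D : Set H) := by
  refine P.cyclic.mono ?_
  rintro _ ⟨x, hx, rfl⟩
  refine StarAlgebra.adjoin_apply_mem ?_ ?_ hx _ P.Ω_mem
  · rintro _ ⟨i, rfl⟩
    exact P.t_mem i
  · rintro _ ⟨i, rfl⟩
    exact P.tStar_mem i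

theorem span_coe_bose_vec :
    Submodule.span ℂ (Set.range fun u => (P.boseSystem.vec u : H)) = P.D := by
  have h : (Set.range fun u => (P.boseSystem.vec u : H)) =
      P.D.subtype '' Set.range P.boseSystem.vec := by
    rw [← Set.range_comp]; rfl
  rw [h, Submodule.span_image, span_bose_vec, Submodule.map_subtype_top]

theorem dense_span_fermi_vec :
    Dense (Submodule.span ℂ (Set.range P.fermiSystem.vec) : Set H) := by
  refine P.dense_D.mono ?_
  refine Submodule.span_le.2 ?_
  rintro _ ⟨w, -, rfl⟩
  rw [← coe_word]
  exact Submodule.span_mono (Set.image_subset_range _ _) (P.coe_word_mem_fermi_sector w)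

end Sectors

end CuntzP21

/-! ### Number vectors of bosons and fermions -/

/-- The modes `n₁, …, n₁, n₂, …, n₂, …`, each `nᵢ` repeated `kᵢ` times. -/
def boseModes {m : ℕ} (n k : Fin m → ℕ) : List ℕ :=
  (List.ofFn fun i => List.replicate (k i) (n i)).flatten

/-- The modes of the consecutive blocks of lengths `kᵢ`, the `i`-th one starting at
`nᵢ + k₁ + ⋯ + kᵢ₋₁`. -/
def fermiModes {m : ℕ} (n k : Fin m → ℕ) : List ℕ :=
  (List.ofFn fun i =>
    (List.range (k i)).map (· + (n i + ∑ j ∈ Finset.Iio i, k j))).flatten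

theorem Fin.sum_Iio_succ_eq {m : ℕ} (k : Fin (m + 1) → ℕ) (i : Fin m) :
    ∑ j ∈ Finset.Iio i.succ, k j = k 0 + ∑ j ∈ Finset.Iio i, k j.succ := by
  have h (l : ℕ) (i : Fin l) : Finset.Iio i = Finset.univ.filter (· < i) := by ext; simp
  rw [h, h, Finset.sum_filter, Finset.sum_filter, Fin.sum_univ_succ]
  simp

/-- Shaped for the operator `(s 0)^(n 0) * s (k 0)`. Strict monotonicity makes the truncated
subtraction exact. -/
theorem boseModes_succ {m : ℕ} {n : Fin (m + 1) → ℕ} (k : Fin (m + 1) → ℕ) (hn : StrictMono n) :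
    boseModes n k = (List.replicate (k 0) 0 ++ (boseModes (fun i => n i.succ - n 0 - 1)
      fun i => k i.succ).map (· + 1)).map (· + n 0) := by
  simp only [boseModes, List.ofFn_succ, List.flatten_cons, List.map_append, List.map_replicate,
    List.map_flatten, List.map_ofFn, zero_add, Function.comp_def]
  congr! 6 with i
  have := hn (Fin.succ_pos i)
  omega

/-- The same recursion with the remainder raised by a further `k 0`, the effect of `(t 1)^(k 0)`. -/
theorem fermiModes_succ {m : ℕ} {n : Fin (m + 1) → ℕ} (k : Fin (m + 1) → ℕ) (hn : StrictMono n) :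
    fermiModes n k = (List.range (k 0) ++ ((fermiModes (fun i => n i.succ - n 0 - 1)
      fun i => k i.succ).map (· + 1)).map (· + k 0)).map (· + n 0) := by
  simp only [fermiModes, List.ofFn_succ, List.flatten_cons, List.map_append,
    List.map_flatten, List.map_ofFn, List.map_map, Function.comp_def, Fin.sum_Iio_succ_eq]
  have h : Finset.Iio (0 : Fin (m + 1)) = ∅ := by ext; simp
  rw [h, Finset.sum_empty, add_zero]
  congr! 6 with i
  have := hn (Fin.succ_pos i)
  omega

namespace CuntzP21

variable {H : Type*} [NormedAddCommGroup H] [InnerProductSpace ℂ H] [CompleteSpace H]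
  (P : CuntzP21 H)

theorem s_zero_pow_bose_vec (r : ℕ) (u : List ℕ) :
    (P.s 0 ^ r) (P.boseSystem.vec u) = P.boseSystem.vec (u.map (· + r)) := by
  induction r with
  | zero => simp
  | succ r ih =>
    rw [pow_succ', Module.End.mul_apply, ih, s_zero_bose_vec, List.map_map]
    rfl

theorem bose_vec_replicate_append (k : ℕ) (u : List ℕ) :
    P.boseSystem.vec (List.replicate k 0 ++ u.map (· + 1)) =
      ((Real.sqrt k.factorial : ℝ) : ℂ) • P.s k (P.boseSystem.vec u) := by
  induction k with
  | zero => simp [s_zero_bose_vec]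
  | succ k ih =>
    rw [List.replicate_succ, List.cons_append, FockSystem.vec_cons, ih, map_smul]
    change _ • P.rbsStar 0 _ = _
    rw [rbsStar_zero_s, smul_smul, ← Complex.ofReal_mul, ← Real.sqrt_mul (by positivity),
      Nat.factorial_succ]
    push_cast
    rw [mul_comm]

theorem t_zero_pow_fermi_vec (r : ℕ) (u : List ℕ) :
    (P.t 0 ^ r) (P.fermiSystem.vec u) = P.fermiSystem.vec (u.map (· + r)) := by
  induction r with
  | zero => simp
  | succ r ih =>
    rw [pow_succ', mul_apply_eq_comp, ih, t_zero_fermi_vec, List.map_map]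
    rfl

theorem t_one_pow_fermi_vec (k : ℕ) (u : List ℕ) :
    (P.t 1 ^ k) (P.fermiSystem.vec u) =
      P.fermiSystem.vec (List.range k ++ u.map (· + k)) := by
  induction k with
  | zero => simp
  | succ k ih =>
    rw [pow_succ', mul_apply_eq_comp, ih, t_one_fermi_vec, List.map_append, List.map_map,
      List.range_succ_eq_map]
    rfl

theorem coe_tD_pow (i : Fin 2) (k : ℕ) (v : P.D) : ((P.tD i ^ k) v : H) = (P.t i ^ k) (v : H) := by
  induction k with
  | zero => rfl
  | succ k ih =>
    rw [pow_succ', pow_succ', Module.End.mul_apply, mul_apply_eq_comp, ← ih]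
    rfl

/-- Comparison of the bosonic and fermionic number vectors inside the representation of `O₂`. -/
theorem coe_bose_vec_boseModes {m : ℕ} {n : Fin m → ℕ} (k : Fin m → ℕ) (hn : StrictMono n) :
    (P.boseSystem.vec (boseModes n k) : H) =
      ((Real.sqrt (∏ i, ((k i).factorial : ℝ)) : ℝ) : ℂ) •
        P.fermiSystem.vec (fermiModes n k) := by
  induction m with
  | zero => simp [boseModes, fermiModes]; rfl
  | succ m ih =>
    have hn' : StrictMono fun i : Fin m => n i.succ - n 0 - 1 := fun i j hij => by
      have h1 := hn (Fin.succ_lt_succ_iff.2 hij)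
      have h2 := hn (Fin.succ_pos i)
      change n i.succ - n 0 - 1 < n j.succ - n 0 - 1
      omega
    have h0 : P.s 0 = P.tD 0 := by simp [s]
    -- Both sides become `(t 0)^(n 0) (t 1)^(k 0) (t 0)` applied to vectors with one mode fewer; the
    -- bosonic side gains the factor `√(k 0)!`.
    rw [boseModes_succ k hn, fermiModes_succ k hn, ← s_zero_pow_bose_vec, ← t_zero_pow_fermi_vec,
      bose_vec_replicate_append, ← t_one_pow_fermi_vec, ← t_zero_fermi_vec, map_smul, h0,
      Submodule.coe_smul, coe_tD_pow, s, Module.End.mul_apply, coe_tD_pow]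
    change _ • (P.t 0 ^ n 0) ((P.t 1 ^ k 0) (P.t 0 (P.boseSystem.vec _ : H))) = _
    rw [ih _ hn', map_smul, map_smul, map_smul, smul_smul, ← Complex.ofReal_mul,
      ← Real.sqrt_mul (by positivity), Fin.prod_univ_succ]

end CuntzP21

theorem FockSystem.prod_ofFn_pow_vac {ε : ℂ} {E : Type*} [NormedAddCommGroup E]
    [InnerProductSpace ℂ E] (S : FockSystem ε E) {m : ℕ} (n k : Fin m → ℕ) :
    (List.ofFn fun i => S.d (n i) ^ k i).prod S.vac = S.vec (boseModes n k) := by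
  rw [vec, boseModes, List.map_flatten, List.prod_flatten, List.map_ofFn, List.map_ofFn]
  simp [Function.comp_def]

theorem FockSystem.sector_eq_span_range {ε : ℂ} {E : Type*} [NormedAddCommGroup E]
    [InnerProductSpace ℂ E] (S : FockSystem ε E) (N : ℕ) :
    S.sector N =
      Submodule.span ℂ (Set.range fun j : Fin N → ℕ => S.vec (List.ofFn j)) := by
  rw [sector]
  congr 1
  ext x
  constructor
  · rintro ⟨u, rfl, rfl⟩
    exact ⟨u.get, by simp⟩
  · rintro ⟨j, rfl⟩
    exact ⟨List.ofFn j, by simp, rfl⟩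

/-! ### The boson equivalence -/

section Bose

variable {H HB : Type*} [NormedAddCommGroup H] [InnerProductSpace ℂ H] [CompleteSpace H]
  [NormedAddCommGroup HB] [InnerProductSpace ℂ HB] [CompleteSpace HB]
  {P : CuntzP21 H} {B : BoseFock HB}

theorem BoseFock.span_coe_vec (B : BoseFock HB) :
    Submodule.span ℂ (Set.range fun u => (B.system.vec u : HB)) = B.dom := by
  have h : (Set.range fun u => (B.system.vec u : HB)) =
      B.dom.subtype '' Set.range B.system.vec := by
    rw [← Set.range_comp]; rfl
  rw [h, Submodule.span_image, span_vec, Submodule.map_subtype_top]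

theorem BoseFock.particle_eq (B : BoseFock HB) (N : ℕ) :
    B.particle N = ((B.system.sector N).map B.dom.subtype).topologicalClosure := by
  rw [particle, FockSystem.sector_eq_span_range, Submodule.map_span, ← Set.range_comp]
  congr! 4 with j
  simp only [Function.comp_apply, FockSystem.vec, List.map_ofFn]
  rfl

theorem IsBoseEquiv.map_vec {V : H ≃ₗᵢ[ℂ] HB} (hV : IsBoseEquiv P B V) (u : List ℕ) :
    V (P.boseSystem.vec u) = B.system.vec u := by
  induction u with
  | nil => exact hV.map_Ω
  | cons n u ih =>
    rw [FockSystem.vec_cons, FockSystem.vec_cons]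
    exact hV.map_bStar n _ _ ih

theorem IsBoseEquiv.unique {V W : H ≃ₗᵢ[ℂ] HB} (hV : IsBoseEquiv P B V)
    (hW : IsBoseEquiv P B W) : V = W := by
  have h : (V.toContinuousLinearEquiv : H →L[ℂ] HB) = W.toContinuousLinearEquiv := by
    refine ContinuousLinearMap.ext_on (s := Set.range fun u => (P.boseSystem.vec u : H)) ?_ ?_
    · rw [P.span_coe_bose_vec]; exact P.dense_D
    · rintro _ ⟨u, rfl⟩
      exact (hV.map_vec u).trans (hW.map_vec u).symm
  ext x
  exact congrArg (fun f : H →L[ℂ] HB => f x) h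

/-- The creation vectors span exactly `P.D` and `B.dom`, not merely dense parts of them, so matching
them also matches the domains. -/
theorem isBoseEquiv_of_map_vec {V : H ≃ₗᵢ[ℂ] HB}
    (hV : ∀ u, V (P.boseSystem.vec u) = B.system.vec u) : IsBoseEquiv P B V := by
  have hdom : P.D.map (V.toLinearEquiv : H →ₗ[ℂ] HB) = B.dom := by
    rw [← P.span_coe_bose_vec, Submodule.map_span, ← B.span_coe_vec, ← Set.range_comp]
    congr 2
    exact funext hV
  have hmem (v : H) : v ∈ P.D ↔ V v ∈ B.dom := by
    rw [← hdom]
    constructor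
    · exact fun h => ⟨v, h, rfl⟩
    · rintro ⟨w, hw, h⟩
      exact V.injective h ▸ hw
  let T : P.D →ₗ[ℂ] B.dom := (V.toLinearEquiv : H →ₗ[ℂ] HB).restrict fun v hv => (hmem v).1 hv
  have hT (u : List ℕ) : T (P.boseSystem.vec u) = B.system.vec u := Subtype.ext (hV u)
  have hc (n : ℕ) : T ∘ₗ P.rbs n = B.b n ∘ₗ T :=
    LinearMap.ext_on P.span_bose_vec fun _ ⟨u, hu⟩ => hu ▸ FockSystem.map_c_vec hT n u
  have hd (n : ℕ) : T ∘ₗ P.rbsStar n = B.bStar n ∘ₗ T :=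
    LinearMap.ext_on P.span_bose_vec fun _ ⟨u, hu⟩ => hu ▸ FockSystem.map_d_vec hT n u
  refine ⟨hV [], hmem, fun n x y hxy => ?_, fun n x y hxy => ?_⟩
  · obtain rfl : T x = y := Subtype.ext hxy
    exact congrArg Subtype.val (LinearMap.congr_fun (hc n) x)
  · obtain rfl : T x = y := Subtype.ext hxy
    exact congrArg Subtype.val (LinearMap.congr_fun (hd n) x)

variable (P B) in
theorem existsUnique_isBoseEquiv : ∃! V : H ≃ₗᵢ[ℂ] HB, IsBoseEquiv P B V := by
  obtain ⟨V, hV⟩ := exists_linearIsometryEquiv_of_inner_eq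
    (u := fun u => (P.boseSystem.vec u : H)) (v := fun u => (B.system.vec u : HB))
    (P.boseSystem.inner_vec_eq B.system) (by rw [P.span_coe_bose_vec]; exact P.dense_D)
    (by rw [B.span_coe_vec]; exact B.dense_dom)
  exact ⟨V, isBoseEquiv_of_map_vec hV, fun W hW => hW.unique (isBoseEquiv_of_map_vec hV)⟩

theorem IsBoseEquiv.map_sector {V : H ≃ₗᵢ[ℂ] HB} (hV : IsBoseEquiv P B V) (N : ℕ) :
    ((P.boseSystem.sector N).map P.D.subtype).map (V.toLinearEquiv : H →ₗ[ℂ] HB) =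
      (B.system.sector N).map B.dom.subtype := by
  simp only [FockSystem.sector, Submodule.map_span, Set.image_image]
  congr 1
  exact Set.image_congr fun u _ => hV.map_vec u

end Bose

/-! ### The fermion equivalence -/

section Fermi

variable {H HF : Type*} [NormedAddCommGroup H] [InnerProductSpace ℂ H] [CompleteSpace H]
  [NormedAddCommGroup HF] [InnerProductSpace ℂ HF] [CompleteSpace HF]
  {P : CuntzP21 H} {F : FermiFock HF}

theorem FermiFock.vec_eq (F : FermiFock HF) (u : List ℕ) :
    F.system.vec u = (u.map fun n => star (F.a n)).prod F.vac := by
  induction u with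
  | nil => rfl
  | cons n u ih =>
    rw [FockSystem.vec_cons, ih, List.map_cons, List.prod_cons]
    rfl

theorem FermiFock.particle_eq (F : FermiFock HF) (N : ℕ) :
    F.particle N = (F.system.sector N).topologicalClosure := by
  rw [particle, FockSystem.sector_eq_span_range]
  simp only [vec_eq, List.map_ofFn]
  rfl

theorem FermiFock.prod_ofFn_block_vac (F : FermiFock HF) {m : ℕ} (n k : Fin m → ℕ) :
    (List.ofFn fun i => F.block (n i + ∑ j ∈ Finset.Iio i, k j) (k i)).prod F.vac =
      F.system.vec (fermiModes n k) := by
  rw [vec_eq, fermiModes, List.map_flatten, List.prod_flatten, List.map_ofFn, List.map_ofFn]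
  congr! 4 with i
  simp only [block, Function.comp_apply, List.map_map]
  congr 1
  exact List.ext_getElem (by simp) fun j _ _ => by simp [add_comm]

theorem IsFermiEquiv.map_vec {V : H ≃ₗᵢ[ℂ] HF} (hV : IsFermiEquiv P F V) (u : List ℕ) :
    V (P.fermiSystem.vec u) = F.system.vec u := by
  induction u with
  | nil => exact hV.map_Ω
  | cons n u ih =>
    rw [FockSystem.vec_cons, FockSystem.vec_cons, ← ih]
    exact hV.map_aStar n _

theorem IsFermiEquiv.unique {V W : H ≃ₗᵢ[ℂ] HF} (hV : IsFermiEquiv P F V)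
    (hW : IsFermiEquiv P F W) : V = W := by
  have h : (V.toContinuousLinearEquiv : H →L[ℂ] HF) = W.toContinuousLinearEquiv := by
    refine ContinuousLinearMap.ext_on P.dense_span_fermi_vec ?_
    rintro _ ⟨u, rfl⟩
    exact (hV.map_vec u).trans (hW.map_vec u).symm
  ext x
  exact congrArg (fun f : H →L[ℂ] HF => f x) h

theorem isFermiEquiv_of_map_vec {V : H ≃ₗᵢ[ℂ] HF}
    (hV : ∀ u, V (P.fermiSystem.vec u) = F.system.vec u) : IsFermiEquiv P F V := by
  let T : H →L[ℂ] HF := V.toContinuousLinearEquiv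
  have hT (u : List ℕ) : (T : H →ₗ[ℂ] HF) (P.fermiSystem.vec u) = F.system.vec u := hV u
  have hc (n : ℕ) : T ∘L P.rfs n = F.a n ∘L T :=
    ContinuousLinearMap.ext_on P.dense_span_fermi_vec
      fun _ ⟨u, hu⟩ => hu ▸ FockSystem.map_c_vec hT n u
  have hd (n : ℕ) : T ∘L star (P.rfs n) = star (F.a n) ∘L T :=
    ContinuousLinearMap.ext_on P.dense_span_fermi_vec
      fun _ ⟨u, hu⟩ => hu ▸ FockSystem.map_d_vec hT n u
  exact ⟨hV [], fun n x => congrArg (fun f : H →L[ℂ] HF => f x) (hc n),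
    fun n x => congrArg (fun f : H →L[ℂ] HF => f x) (hd n)⟩

variable (P F) in
theorem existsUnique_isFermiEquiv : ∃! V : H ≃ₗᵢ[ℂ] HF, IsFermiEquiv P F V := by
  obtain ⟨V, hV⟩ := exists_linearIsometryEquiv_of_inner_eq
    (P.fermiSystem.inner_vec_eq F.system) P.dense_span_fermi_vec F.dense_span_vec
  exact ⟨V, isFermiEquiv_of_map_vec hV, fun W hW => hW.unique (isFermiEquiv_of_map_vec hV)⟩

theorem IsFermiEquiv.map_sector {V : H ≃ₗᵢ[ℂ] HF} (hV : IsFermiEquiv P F V) (N : ℕ) :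
    (P.fermiSystem.sector N).map (V.toLinearEquiv : H →ₗ[ℂ] HF) = F.system.sector N := by
  simp only [FockSystem.sector, Submodule.map_span, Set.image_image]
  congr 1
  exact Set.image_congr fun u _ => hV.map_vec u

end Fermi

end

/-! ### The unitary between the Fock spaces -/

theorem theorem1p1 {H HB HF : Type*}
    [NormedAddCommGroup H] [InnerProductSpace ℂ H] [CompleteSpace H]
    [NormedAddCommGroup HB] [InnerProductSpace ℂ HB] [CompleteSpace HB]
    [NormedAddCommGroup HF] [InnerProductSpace ℂ HF] [CompleteSpace HF]
    (P : CuntzP21 H) (B : BoseFock HB) (F : FermiFock HF) :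
    (∃! VB : H ≃ₗᵢ[ℂ] HB, IsBoseEquiv P B VB) ∧
    (∃! VF : H ≃ₗᵢ[ℂ] HF, IsFermiEquiv P F VF) ∧
    ∀ (VB : H ≃ₗᵢ[ℂ] HB) (VF : H ≃ₗᵢ[ℂ] HF) (U : HB ≃ₗᵢ[ℂ] HF),
      IsBoseEquiv P B VB → IsFermiEquiv P F VF → U = VB.symm.trans VF →
      (U B.vac = F.vac ∧
        ∀ (m : ℕ) (n k : Fin m → ℕ), StrictMono n → (∀ i, 1 ≤ k i) →
          U ((List.ofFn fun i => B.bStar (n i) ^ k i).prod B.vac : B.dom) =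
            ((Real.sqrt (∏ i, ((k i).factorial : ℝ)) : ℝ) : ℂ) •
              (List.ofFn fun i =>
                F.block (n i + ∑ j ∈ Finset.Iio i, k j) (k i)).prod F.vac) ∧
      ∀ N : ℕ, U '' (B.particle N : Set HB) = (F.particle N : Set HF) := by
  refine ⟨existsUnique_isBoseEquiv P B, existsUnique_isFermiEquiv P F, ?_⟩
  rintro VB VF U hB hF rfl
  have hU (x : H) : (VB.symm.trans VF) (VB x) = VF x := by simp
  refine ⟨⟨?_, fun m n k hn _ => ?_⟩, fun N => ?_⟩
  · rw [← hB.map_Ω, hU, hF.map_Ω]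
  · have h : (List.ofFn fun i => B.bStar (n i) ^ k i).prod B.vac =
        B.system.vec (boseModes n k) := B.system.prod_ofFn_pow_vac n k
    rw [h, F.prod_ofFn_block_vac, ← hB.map_vec, hU, P.coe_bose_vec_boseModes k hn, map_smul,
      hF.map_vec]
  -- Pulled back to `H`, both algebraic sectors are the image of `wordSector N`; a homeomorphism
  -- commutes with closure.
  · rw [B.particle_eq, F.particle_eq, Submodule.topologicalClosure_coe,
      Submodule.topologicalClosure_coe, ← hB.map_sector, ← hF.map_sector, P.fermi_sector_eq,
      P.bose_sector_eq, Submodule.map_coe _ (Submodule.map _ _),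
      Submodule.map_coe _ (Submodule.map _ _)]
    change (VB.symm.trans VF).toHomeomorph '' _ = _
    rw [Homeomorph.image_closure, Set.image_image]
    congr 1
    exact Set.image_congr fun x _ => hU x
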